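/- Let $2\le p<\infty$, $k\ge 3$, $0<\alpha<1$. Write $\gamma_p(x)=(|x_1|^p+|x_2|^p)^{1/p}$ on $\mathbb{R}^2$. Let $U\subset\mathbb{R}^2$ be a bounded simply connected open set whose boundary is a simple closed Jordan curve made up of finitely many regular arcs that are $C^{k,\alpha}$ (for instance analytic) up to their endpoints, and suppose that at every vertex (common endpoint of consecutive arcs) the opening angle of $U$ is less than $\pi$; there may also be no vertex at all, in which case $\partial U$ is a regular closed $C^{k,\alpha}$ curve. Put $d_p(x)=\min_{y\in\partial U}\gamma_p(x-y)$, and call $y\in\partial U$ a $p$-closest point to $x$ if $\gamma_p(x-y)=d_p(x)$. The $p$-ridge $R_p$ is the complement in $U$ of the largest open subset of $U$ on which $d_p$ is (locally) $C^{1,1}$. Assume the following at every point $y_0$ of a closed arc (endpoints included) at which the normal to the arc is parallel to a coordinate axis. After interchanging the coordinates and reflecting if necessary, the arc is near $y_0=(a_0,b(0))$ parametrized by $s\mapsto(a_0+s,b(s))$ (with $s$ in a one-sided neighborhood of $0$ if $y_0$ is an endpoint), where $b'(0)=0$ and, when $y_0$ is not a vertex, $U$ lies above the arc near $y_0$. Then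 $b'(s)=c(s)|c(s)|^{p-2}$ near $0$ for some $C^{k-1,\alpha}$ function $c$ with $c(0)=0$, and $1-c'(0)\,d_p(x)\neq0$ for every $x\in U$ that has $y_0$ as its only $p$-closest point on $\partial U$. Then every point $y_0\in\partial U$ that is not a vertex has a neighborhood $W$ in $\mathbb{R}^2$ such that $W\cap U$ does not intersect $R_p$. -/

import Mathlib

open Set Filter Topology
open scoped NNReal

noncomputable section

/-- The `p`-norm `γ_p` on the plane. -/
def pNorm (p : ℝ) (x : ℝ × ℝ) : ℝ := (|x.1| ^ p + |x.2| ^ p) ^ (1 / p)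

/-- The `p`-distance `d_p(x) = d_p(x, ∂U)` to the boundary of `U`. -/
def pDist (p : ℝ) (U : Set (ℝ × ℝ)) (x : ℝ × ℝ) : ℝ :=
  sInf ((fun y => pNorm p (x - y)) '' frontier U)

/-- `y` is a `p`-closest point to `x` on `∂U`. -/
def IsPClosest (p : ℝ) (U : Set (ℝ × ℝ)) (x y : ℝ × ℝ) : Prop :=
  y ∈ frontier U ∧ pNorm p (x - y) = pDist p U x

/-- `g` is (locally) `C^{1,1}` on the open set `W`. -/
def IsC11On (g : ℝ × ℝ → ℝ) (W : Set (ℝ × ℝ)) : Prop :=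
  DifferentiableOn ℝ g W ∧ LocallyLipschitzOn W (fderiv ℝ g)

/-- The `p`-ridge: the complement in `U` of the largest open subset of `U` on which `d_p` is
`C^{1,1}`. -/
def pRidge (p : ℝ) (U : Set (ℝ × ℝ)) : Set (ℝ × ℝ) :=
  U \ ⋃₀ {W | IsOpen W ∧ W ⊆ U ∧ IsC11On (pDist p U) W}

/-- `g` is `C^{k,α}` on `s` (used for nondegenerate compact intervals `s`, so that derivatives at
the endpoints are one-sided). -/
def IsCkHolderOn {E : Type*} [NormedAddCommGroup E] [NormedSpace ℝ E]
    (k : ℕ) (α : ℝ≥0) (g : ℝ → E) (s : Set ℝ) : Prop :=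
  ContDiffOn ℝ k g s ∧ ∃ C : ℝ≥0, HolderOnWith C α (iteratedDerivWithin k g s) s

/-- `f` restricted to `[a, b]` runs along (a part of) one closed boundary arc: no vertex is met
in the interior of the interval. The endpoints may be sent to vertices. -/
def IsArc (V : Set (ℝ × ℝ)) (f : ℝ → ℝ × ℝ) (a b : ℝ) : Prop :=
  a < b ∧ ∀ t ∈ Ioo a b, f t ∉ V

/-- `U` has at `v` an opening angle less than `π`: close to `v` it is contained in a closed sector
with apex `v` and opening less than `π`. -/
def IsNonreentrant (U : Set (ℝ × ℝ)) (v : ℝ × ℝ) : Prop :=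
  ∃ (e : ℝ × ℝ) (m : ℝ), 0 < m ∧
    ∀ᶠ x in 𝓝 v, x ∈ U → m * ‖x - v‖ ≤ e.1 * (x.1 - v.1) + e.2 * (x.2 - v.2)

/-- `U` is a bounded simply connected open set whose boundary is a simple closed Jordan curve,
traversed once by the `L`-periodic map `f`, with finite set of vertices `V` (possibly empty); the
arcs between consecutive vertices are regular and `C^{k,α}` up to their endpoints, and all
vertices are nonreentrant corners. -/
structure IsPiecewiseSmoothDomain (k : ℕ) (α : ℝ≥0) (U V : Set (ℝ × ℝ)) (L : ℝ)
    (f : ℝ → ℝ × ℝ) : Prop where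
  isOpen : IsOpen U
  isBounded : Bornology.IsBounded U
  simplyConnected : IsSimplyConnected U
  period_pos : 0 < L
  periodic : Function.Periodic f L
  continuous : Continuous f
  injOn : InjOn f (Ico 0 L)
  range_eq : range f = frontier U
  finite_vertices : V.Finite
  vertices_subset : V ⊆ frontier U
  arc_smooth : ∀ a b, IsArc V f a b → IsCkHolderOn k α f (Icc a b)
  arc_regular : ∀ a b, IsArc V f a b → ∀ t ∈ Icc a b, derivWithin f (Icc a b) t ≠ 0
  nonreentrant : ∀ v ∈ V, IsNonreentrant U v

/-- The smallness condition on the curvature at the points where the normal to an arc is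
vertical. Whenever `s ↦ (a₀ + s, b s)`, `s ∈ [s₁, s₂] ∋ 0`, parametrizes a part of a closed arc
and `b'(0) = 0`, one has `b' = c |c|^{p-2}` near `0` with `c` of class `C^{k-1,α}` and `c 0 = 0`;
moreover `1 - c'(0) d_p` does not vanish at the points of `U` whose only `p`-closest boundary
point is `(a₀, b 0)`. The point may be an endpoint of the arc, in which case `0` is an endpoint of
`[s₁, s₂]`. The sign `ε` is `1` if `U` lies above the arc at that point; if `U` lies below it, the
condition is the one obtained by reflection, which replaces `b, c` by `-b, -c`.
(As the arc is `C^{k,α}` and regular, such a `b` is automatically `C^{k,α}`.) -/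
def VerticalNormalCondition (p : ℝ) (k : ℕ) (α : ℝ≥0) (U V : Set (ℝ × ℝ))
    (f : ℝ → ℝ × ℝ) : Prop :=
  ∀ t₁ t₂ : ℝ, IsArc V f t₁ t₂ →
  ∀ (a₀ s₁ s₂ : ℝ) (b : ℝ → ℝ), s₁ < s₂ → (0 : ℝ) ∈ Icc s₁ s₂ →
    ContDiffOn ℝ k b (Icc s₁ s₂) →
    MapsTo (fun s => (a₀ + s, b s)) (Icc s₁ s₂) (f '' Icc t₁ t₂) →
    derivWithin b (Icc s₁ s₂) 0 = 0 →
    ∃ (c : ℝ → ℝ) (δ : ℝ), 0 < δ ∧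
      IsCkHolderOn (k - 1) α c (Icc s₁ s₂ ∩ Icc (-δ) δ) ∧
      c 0 = 0 ∧
      (∀ s ∈ Icc s₁ s₂ ∩ Icc (-δ) δ,
        derivWithin b (Icc s₁ s₂) s = c s * |c s| ^ (p - 2)) ∧
      ∀ ε : ℝ, (ε = 1 ∨ ε = -1) →
        (∀ᶠ t in 𝓝[>] (0 : ℝ), (a₀, b 0 + ε * t) ∈ U) →
        ∀ x ∈ U, (∀ y, IsPClosest p U x y ↔ y = (a₀, b 0)) →
          1 - ε * derivWithin c (Icc s₁ s₂ ∩ Icc (-δ) δ) 0 * pDist p U x ≠ 0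

/-- The smallness condition on the curvature at all points where the normal to an arc is parallel
to one of the two coordinate axes; the horizontal case is the vertical one with the coordinates
interchanged. -/
def AxisNormalCondition (p : ℝ) (k : ℕ) (α : ℝ≥0) (U V : Set (ℝ × ℝ))
    (f : ℝ → ℝ × ℝ) : Prop :=
  VerticalNormalCondition p k α U V f ∧
  VerticalNormalCondition p k α (Prod.swap '' U) (Prod.swap '' V) (Prod.swap ∘ f)

end

/-! Near a parameter `t₀` of a point of `∂U` which is not a vertex, write the velocity of the
boundary curve as `f' = (m₁ |m₁| ^ (p - 2), m₂ |m₂| ^ (p - 2))`. The axis normal condition says that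
`m` can be taken of class `C¹` also where a component of `f'` vanishes. The map
`z ↦ z |z| ^ (p - 2)` is multiplicative, odd and injective, so the first order condition for `f t`
to be `p`-closest to `x` becomes the bilinear equation
`(x₁ - f₁ t) m₁ t + (x₂ - f₂ t) m₂ t = 0`. At `x = f t₀` its `t`-derivative is
`-(|m₁| ^ p + |m₂| ^ p) ≠ 0`, and the implicit function theorem provides a `C¹` map `π` sending each
`x` near `f t₀` to a `p`-closest point.

The function `γ_p(· - π x) - d_p` is nonnegative and vanishes at `x`, hence
`∇d_p(x) = ∇γ_p(x - π x)`. As `γ_p` is of class `C²` away from the origin when `p ≥ 2`, so is `d_p`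
near `f t₀` and off `∂U`.
-/

theorem exists_contDiffAt_implicit {E : Type*} [NormedAddCommGroup E] [NormedSpace ℝ E]
    [CompleteSpace E] {n : WithTop ℕ∞} (hn : n ≠ 0) {Φ : E × ℝ → ℝ} {x : E} {t d : ℝ}
    (hΦ : ContDiffAt ℝ n Φ (x, t)) (hd : HasDerivAt (fun s => Φ (x, s)) d t) (hd₀ : d ≠ 0) :
    ∃ τ : E → ℝ, τ x = t ∧ ContDiffAt ℝ n τ x ∧
      ∀ᶠ v in 𝓝 (x, t), Φ v = Φ (x, t) ↔ τ v.1 = v.2 := by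
  have hpartial : fderiv ℝ Φ (x, t) ∘L .inr ℝ E ℝ = .toSpanSingleton ℝ d :=
    ((hΦ.differentiableAt hn).hasFDerivAt.comp t (hasFDerivAt_prodMk_right x t)).unique
      hd.hasFDerivAt
  have hinv : (fderiv ℝ Φ (x, t) ∘L .inr ℝ E ℝ).IsInvertible :=
    ⟨ContinuousLinearEquiv.unitsEquivAut ℝ (Units.mk0 d hd₀), by rw [hpartial]; ext; simp⟩
  exact ⟨hΦ.implicitFunction hn hinv, hΦ.implicitFunction_apply_self hn hinv,
    hΦ.contDiffAt_implicitFunction hn hinv, hΦ.eventually_apply_eq_iff_implicitFunction hn hinv⟩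

theorem map_nhds_of_periodic_of_injOn {E : Type*} [TopologicalSpace E] [T2Space E] {f : ℝ → E}
    {L : ℝ} (hL : 0 < L) (hf : Function.Periodic f L) (hcont : Continuous f)
    (hinj : InjOn f (Ico 0 L)) (t : ℝ) : map f (𝓝 t) = 𝓝[range f] (f t) := by
  have : Fact (0 < L) := ⟨hL⟩
  have hlift : Continuous hf.lift := hcont.quotient_lift _
  have hlift_inj : Function.Injective hf.lift := by
    intro u v huv
    obtain ⟨s, hs, rfl⟩ := AddCircle.eq_coe_Ico u
    obtain ⟨r, hr, rfl⟩ := AddCircle.eq_coe_Ico v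
    rw [hinj hs hr huv]
  have hrange : range hf.lift = range f := (QuotientAddGroup.mk_surjective.range_comp hf.lift).symm
  calc map f (𝓝 t) = map hf.lift (map ((↑) : ℝ → AddCircle L) (𝓝 t)) := rfl
    _ = map hf.lift (𝓝 (t : AddCircle L)) := by
        rw [QuotientAddGroup.isOpenMap_coe.map_nhds_eq QuotientAddGroup.continuous_mk.continuousAt]
    _ = 𝓝[range f] (f t) := by
        rw [(hlift.isClosedEmbedding hlift_inj).isEmbedding.map_nhds_eq, hrange]; rfl

/-- The duality map `z ↦ z |z| ^ (p - 2)` of the `p`-norm on the line, that is, the derivative of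
`|z| ^ p / p`. It is the nonlinearity relating `b'` to `c` in `VerticalNormalCondition`. -/
noncomputable def pDual (p z : ℝ) : ℝ := z * |z| ^ (p - 2)

theorem pDual_neg (p z : ℝ) : pDual p (-z) = -pDual p z := by
  simp [pDual]

theorem pDual_mul (p z w : ℝ) : pDual p (z * w) = pDual p z * pDual p w := by
  simp only [pDual, abs_mul, Real.mul_rpow (abs_nonneg z) (abs_nonneg w)]
  ring

theorem pDual_mul_self {p : ℝ} (hp : p ≠ 0) (z : ℝ) : pDual p z * z = |z| ^ p := by
  rcases eq_or_ne z 0 with rfl | hz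
  · simp [Real.zero_rpow hp]
  · calc pDual p z * z = |z| ^ (p - 2) * |z| ^ (2 : ℝ) := by
          rw [Real.rpow_two, sq_abs, pDual]; ring
      _ = |z| ^ p := by rw [← Real.rpow_add (abs_pos.2 hz), sub_add_cancel]

theorem pDual_pDual {p q : ℝ} (hpq : p.HolderConjugate q) (z : ℝ) : pDual p (pDual q z) = z := by
  rcases eq_or_ne z 0 with rfl | hz
  · simp [pDual]
  have hz' : 0 < |z| := abs_pos.2 hz
  have hexp : q - 2 + (1 + (q - 2)) * (p - 2) = 0 := by linear_combination hpq.mul_eq_add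
  calc pDual p (pDual q z) = z * (|z| ^ (q - 2) * (|z| ^ (1 + (q - 2))) ^ (p - 2)) := by
        rw [Real.rpow_one_add' hz'.le (by linarith [hpq.symm.lt]), pDual, pDual, abs_mul,
          abs_of_pos (Real.rpow_pos_of_pos hz' _), mul_assoc]
    _ = z := by rw [← Real.rpow_mul hz'.le, ← Real.rpow_add hz', hexp, Real.rpow_zero, mul_one]

theorem pDual_injective {p : ℝ} (hp : 1 < p) : Function.Injective (pDual p) :=
  Function.LeftInverse.injective (pDual_pDual (Real.HolderConjugate.conjExponent hp).symm)

theorem contDiffAt_pDual {p z : ℝ} (hz : z ≠ 0) : ContDiffAt ℝ 1 (pDual p) z :=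
  contDiffAt_id.mul ((contDiffAt_abs hz).rpow_const_of_ne (abs_ne_zero.2 hz))

theorem continuous_abs_rpow {q : ℝ} (hq : 0 ≤ q) : Continuous fun z : ℝ => |z| ^ q :=
  continuous_abs.rpow_const fun _ => Or.inr hq

theorem hasDerivAt_pDual {p : ℝ} (hp : 2 ≤ p) (z : ℝ) :
    HasDerivAt (pDual p) ((p - 1) * |z| ^ (p - 2)) z := by
  have hcont : Continuous fun z : ℝ => |z| ^ (p - 2) := continuous_abs_rpow (by linarith)
  refine hasDerivAt_of_hasDerivAt_of_ne' (g := fun z => (p - 1) * |z| ^ (p - 2)) (x := 0)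
    (fun y hy => ?_) (continuous_id.mul hcont).continuousAt (hcont.const_mul _).continuousAt z
  have hpow : |y| ^ (p - 2 - 1) * |y| = |y| ^ (p - 2) := by
    rw [← Real.rpow_add_one (abs_ne_zero.2 hy), sub_add_cancel]
  have hder := (hasDerivAt_id y).mul
    ((hasDerivAt_abs hy).rpow_const (p := p - 2) (Or.inl (abs_ne_zero.2 hy)))
  refine hder.congr_deriv ?_
  rw [id]
  linear_combination (p - 2) * hpow + (p - 2) * |y| ^ (p - 2 - 1) * self_mul_sign y

theorem contDiff_pDual {p : ℝ} (hp : 2 ≤ p) : ContDiff ℝ 1 (pDual p) := by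
  refine contDiff_one_iff_deriv.2 ⟨fun z => (hasDerivAt_pDual hp z).differentiableAt, ?_⟩
  rw [funext fun z => (hasDerivAt_pDual hp z).deriv]
  exact (continuous_abs_rpow (by linarith)).const_mul _

theorem hasDerivAt_abs_rpow_pDual {p : ℝ} (hp : 1 < p) (z : ℝ) :
    HasDerivAt (fun z : ℝ => |z| ^ p) (p * pDual p z) z :=
  (hasDerivAt_abs_rpow z hp).congr_deriv (by rw [pDual]; ring)

theorem continuous_pDual {p : ℝ} (hp : 1 < p) : Continuous (pDual p) := by
  have hderiv : deriv (fun z : ℝ => ‖z‖ ^ p) = fun z => p * pDual p z :=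
    funext fun z => (hasDerivAt_abs_rpow_pDual hp z).deriv
  have hcont : Continuous fun z => p⁻¹ * (p * pDual p z) :=
    (hderiv ▸ (contDiff_norm_rpow hp).continuous_deriv le_rfl).const_mul p⁻¹
  simpa only [inv_mul_cancel_left₀ (by linarith : p ≠ 0)] using hcont

theorem contDiff_abs_rpow {p : ℝ} (hp : 2 ≤ p) : ContDiff ℝ 2 fun z : ℝ => |z| ^ p := by
  have hderiv := hasDerivAt_abs_rpow_pDual (by linarith : 1 < p)
  refine contDiff_succ_iff_deriv (n := 1).2
    ⟨fun z => (hderiv z).differentiableAt, by simp, ?_⟩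
  rw [funext fun z => (hderiv z).deriv]
  exact contDiff_const.mul (contDiff_pDual hp)

theorem pNorm_zero {p : ℝ} (hp : 0 < p) : pNorm p 0 = 0 := by
  simp [pNorm, Real.zero_rpow hp.ne', Real.zero_rpow (inv_pos.2 hp).ne']

theorem pNorm_nonneg (p : ℝ) (x : ℝ × ℝ) : 0 ≤ pNorm p x := by
  unfold pNorm; positivity

theorem pNorm_rpow {p : ℝ} (hp : 0 < p) (x : ℝ × ℝ) : pNorm p x ^ p = |x.1| ^ p + |x.2| ^ p := by
  rw [pNorm, ← Real.rpow_mul (by positivity), one_div_mul_cancel hp.ne', Real.rpow_one]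

theorem norm_le_pNorm {p : ℝ} (hp : 0 < p) (x : ℝ × ℝ) : ‖x‖ ≤ pNorm p x := by
  refine max_le ?_ ?_ <;>
    refine (Real.rpow_le_rpow_iff (norm_nonneg _) (pNorm_nonneg p x) hp).1 ?_ <;>
    rw [pNorm_rpow hp, Real.norm_eq_abs]
  · exact le_add_of_nonneg_right (by positivity)
  · exact le_add_of_nonneg_left (by positivity)

theorem continuous_pNorm {p : ℝ} (hp : 0 < p) : Continuous (pNorm p) :=
  (((continuous_abs_rpow hp.le).comp continuous_fst).add
    ((continuous_abs_rpow hp.le).comp continuous_snd)).rpow_const fun _ => Or.inr (by positivity)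

theorem contDiffAt_pNorm {p : ℝ} (hp : 2 ≤ p) {x : ℝ × ℝ} (hx : x ≠ 0) :
    ContDiffAt ℝ 2 (pNorm p) x := by
  have hp0 : 0 < p := by linarith
  have hpos : 0 < pNorm p x := (norm_pos_iff.2 hx).trans_le (norm_le_pNorm hp0 x)
  refine ContDiffAt.rpow_const_of_ne (ContDiff.contDiffAt ?_) ?_
  · exact ((contDiff_abs_rpow hp).comp contDiff_fst).add ((contDiff_abs_rpow hp).comp contDiff_snd)
  · rw [← pNorm_rpow hp0]
    positivity

theorem pDual_mul_self_add_ne_zero {p : ℝ} (hp : 0 < p) {m : ℝ × ℝ} (hm : m ≠ 0) :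
    pDual p m.1 * m.1 + pDual p m.2 * m.2 ≠ 0 := by
  rw [pDual_mul_self hp.ne', pDual_mul_self hp.ne', ← pNorm_rpow hp]
  have hpos : 0 < pNorm p m := (norm_pos_iff.2 hm).trans_le (norm_le_pNorm hp m)
  positivity

section ClosestPoints

variable {p : ℝ} {U : Set (ℝ × ℝ)} {x y : ℝ × ℝ}

theorem pDist_le_pNorm_sub (p : ℝ) (x : ℝ × ℝ) (hy : y ∈ frontier U) :
    pDist p U x ≤ pNorm p (x - y) :=
  csInf_le ⟨0, forall_mem_image.2 fun _ _ => pNorm_nonneg _ _⟩ (mem_image_of_mem _ hy)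

theorem exists_isPClosest (hp : 0 < p) (hU : (frontier U).Nonempty) (x : ℝ × ℝ) :
    ∃ y, IsPClosest p U x y := by
  obtain ⟨y₁, hy₁⟩ := hU
  have hcont : Continuous fun y => pNorm p (x - y) :=
    (continuous_pNorm hp).comp (continuous_sub_left x)
  have hcoercive : Tendsto (fun y => pNorm p (x - y)) (cocompact (ℝ × ℝ)) atTop :=
    tendsto_atTop_mono (fun y => norm_le_pNorm hp (x - y)) <|
      (tendsto_norm_cocompact_atTop (E := ℝ × ℝ)).comp
        (Homeomorph.subLeft x).isClosedEmbedding.tendsto_cocompact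
  obtain ⟨y, hy, hmin⟩ := hcont.continuousOn.exists_isMinOn' isClosed_frontier hy₁
    ((hcoercive.eventually_ge_atTop _).filter_mono inf_le_left)
  have hle : ∀ z ∈ frontier U, pNorm p (x - y) ≤ pNorm p (x - z) := fun z hz => hmin hz
  have hleast : IsLeast ((fun y => pNorm p (x - y)) '' frontier U) (pNorm p (x - y)) :=
    ⟨mem_image_of_mem _ hy, forall_mem_image.2 hle⟩
  exact ⟨y, hy, hleast.csInf_eq.symm⟩

theorem eventually_forall_isPClosest (hp : 0 < p) (hy : y ∈ frontier U) {q : ℝ × ℝ → Prop}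
    (hq : ∀ᶠ z in 𝓝 y, q z) : ∀ᶠ x in 𝓝 y, ∀ z, IsPClosest p U x z → q z := by
  obtain ⟨r, hr, hball⟩ := Metric.eventually_nhds_iff.1 hq
  have hcont : Continuous fun x => ‖x - y‖ + pNorm p (x - y) :=
    (continuous_sub_right y).norm.add ((continuous_pNorm hp).comp (continuous_sub_right y))
  have hlt : ‖y - y‖ + pNorm p (y - y) < r := by simpa [pNorm_zero hp] using hr
  filter_upwards [hcont.continuousAt.eventually (gt_mem_nhds hlt)] with x hx z hz
  refine hball ?_
  calc dist z y ≤ ‖x - y‖ + ‖x - z‖ := by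
        simpa only [dist_eq_norm, add_comm] using dist_triangle_left z y x
    _ ≤ ‖x - y‖ + pNorm p (x - y) := by
        gcongr
        exact (norm_le_pNorm hp _).trans (hz.2.le.trans (pDist_le_pNorm_sub p x hy))
    _ < r := hx

theorem IsPClosest.orthogonal_of_hasDerivAt (hp : 1 < p) {f : ℝ → ℝ × ℝ} {m : ℝ × ℝ} {t : ℝ}
    (h : IsPClosest p U x (f t)) (hf : HasDerivAt f (pDual p m.1, pDual p m.2) t)
    (hfU : ∀ᶠ s in 𝓝 t, f s ∈ frontier U) :
    (x.1 - (f t).1) * m.1 + (x.2 - (f t).2) * m.2 = 0 := by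
  have hp0 : 0 < p := by linarith
  have hmin : IsLocalMin (fun s => |x.1 - (f s).1| ^ p + |x.2 - (f s).2| ^ p) t := by
    filter_upwards [hfU] with s hs
    have hle : pNorm p (x - f t) ≤ pNorm p (x - f s) := h.2.le.trans (pDist_le_pNorm_sub p x hs)
    simpa only [pNorm_rpow hp0, Prod.fst_sub, Prod.snd_sub]
      using Real.rpow_le_rpow (pNorm_nonneg _ _) hle hp0.le
  have hpow : ∀ {g : ℝ → ℝ} {g' : ℝ} (z : ℝ), HasDerivAt g g' t →
      HasDerivAt (fun s => |z - g s| ^ p) (p * pDual p (z - g t) * -g') t := fun z hg =>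
    (hasDerivAt_abs_rpow_pDual hp _).comp t (hg.const_sub z)
  have hstat := hmin.hasDerivAt_eq_zero ((hpow x.1 hf.fst).add (hpow x.2 hf.snd))
  refine eq_neg_iff_add_eq_zero.1 (pDual_injective hp ?_)
  rw [pDual_neg, pDual_mul, pDual_mul]
  exact mul_left_cancel₀ hp0.ne' (by linear_combination -hstat)

theorem hasFDerivAt_pDist {π : ℝ × ℝ → ℝ × ℝ} (hπ : DifferentiableAt ℝ π x)
    (hclosest : ∀ᶠ z in 𝓝 x, IsPClosest p U z (π z))
    (hp : DifferentiableAt ℝ (pNorm p) (x - π x)) :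
    HasFDerivAt (pDist p U) (fderiv ℝ (pNorm p) (x - π x)) x := by
  have hd : DifferentiableAt ℝ (pDist p U) x :=
    (DifferentiableAt.comp (f := fun z => z - π z) x hp (by fun_prop)).congr_of_eventuallyEq
      (hclosest.mono fun z hz => hz.2.symm)
  have htouch : HasFDerivAt (fun z => pNorm p (z - π x)) (fderiv ℝ (pNorm p) (x - π x)) x :=
    HasFDerivAt.comp (f := fun z => z - π x) x hp.hasFDerivAt (hasFDerivAt_sub_const (π x))
  obtain ⟨hπU, hπx⟩ := hclosest.self_of_nhds
  have hmin : IsLocalMin (fun z => pNorm p (z - π x) - pDist p U z) x := .of_forall fun z => by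
    simpa only [hπx, sub_self, sub_nonneg] using pDist_le_pNorm_sub p z hπU
  rw [sub_eq_zero.1 (hmin.hasFDerivAt_eq_zero (htouch.sub hd.hasFDerivAt))]
  exact hd.hasFDerivAt

theorem contDiffAt_pDist (hp : 2 ≤ p) {π : ℝ × ℝ → ℝ × ℝ} (hπ : ContDiffAt ℝ 1 π x)
    (hclosest : ∀ᶠ z in 𝓝 x, IsPClosest p U z (π z)) (hx : x ∉ frontier U) :
    ContDiffAt ℝ 2 (pDist p U) x := by
  have hne : x - π x ≠ 0 := sub_ne_zero.2 fun h => hx (h ▸ hclosest.self_of_nhds.1)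
  have hpNorm : ContDiffAt ℝ 2 (pNorm p) (x - π x) := contDiffAt_pNorm hp hne
  have hsub : ContDiffAt ℝ 1 (fun z => z - π z) x := contDiffAt_id.sub hπ
  refine (contDiffAt_succ_iff_hasFDerivAt (n := 1)).2
    ⟨fun z => fderiv ℝ (pNorm p) (z - π z), ⟨_, ?_, fun z hz => hz⟩,
      (hpNorm.fderiv_right (m := 1) (by norm_num)).comp x hsub⟩
  filter_upwards [hπ.eventually (by simp), hclosest.eventually_nhds,
    hsub.continuousAt.eventually (hpNorm.eventually (by simp))] with z hπz hcz hpz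
  exact hasFDerivAt_pDist (hπz.differentiableAt (by simp)) hcz (hpz.differentiableAt (by simp))

end ClosestPoints

theorem isC11On_of_contDiffOn {g : ℝ × ℝ → ℝ} {W : Set (ℝ × ℝ)} (hW : IsOpen W)
    (hg : ContDiffOn ℝ 2 g W) : IsC11On g W := by
  refine ⟨hg.differentiableOn (by simp), fun x hx => ?_⟩
  have hg' : ContDiffAt ℝ 1 (fderiv ℝ g) x :=
    (hg.contDiffAt (hW.mem_nhds hx)).fderiv_right (by norm_num)
  obtain ⟨K, t, ht, hK⟩ := hg'.exists_lipschitzOnWith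
  exact ⟨K, t, mem_nhdsWithin_of_mem_nhds ht, hK⟩

theorem notMem_pRidge_of_contDiffAt {p : ℝ} {U : Set (ℝ × ℝ)} (hU : IsOpen U) {x : ℝ × ℝ}
    (hx : x ∈ U) (hd : ContDiffAt ℝ 2 (pDist p U) x) : x ∉ pRidge p U := by
  obtain ⟨N, hN, hdN⟩ := hd.contDiffOn le_rfl (by simp)
  obtain ⟨W, hWN, hW, hxW⟩ := mem_nhds_iff.1 (inter_mem hN (hU.mem_nhds hx))
  exact fun hR => hR.2 ⟨W, ⟨hW, hWN.trans inter_subset_right,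
    isC11On_of_contDiffOn hW (hdN.mono (hWN.trans inter_subset_left))⟩, hxW⟩

/-- `f` runs near `t₀` through a regular arc adapted to the `p`-norm: its velocity is the
coordinatewise image under `pDual p` of a nonvanishing field `m` of class `C¹`. Rotating `m` by a
right angle gives the direction in which `p`-closest points are seen from `f t`. For a graph
`s ↦ (a + s, b s)` with `b' = c |c| ^ (p - 2)` one may take `m = (1, c)`. -/
def IsPRegularAt (p : ℝ) (f : ℝ → ℝ × ℝ) (t₀ : ℝ) : Prop :=
  ∃ m : ℝ → ℝ × ℝ, ContDiffAt ℝ 1 m t₀ ∧ m t₀ ≠ 0 ∧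
    ∀ᶠ t in 𝓝 t₀, HasDerivAt f (pDual p (m t).1, pDual p (m t).2) t

theorem IsPRegularAt.contDiffAt {p : ℝ} (hp : 1 < p) {f : ℝ → ℝ × ℝ} {t₀ : ℝ}
    (hf : IsPRegularAt p f t₀) : ContDiffAt ℝ 1 f t₀ := by
  obtain ⟨m, hm, -, hfm⟩ := hf
  refine (contDiffAt_succ_iff_hasFDerivAt (n := 0)).2
    ⟨_, ⟨_, hfm, fun t ht => ht.hasFDerivAt⟩, ?_⟩
  have hdual : ContDiff ℝ 0 (pDual p) := contDiff_zero.2 (continuous_pDual hp)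
  have hm0 : ContDiffAt ℝ 0 m t₀ := hm.of_le (by simp)
  have hv : ContDiffAt ℝ 0 (fun t => (pDual p (m t).1, pDual p (m t).2)) t₀ :=
    (hdual.contDiffAt.comp t₀ hm0.fst).prodMk (hdual.contDiffAt.comp t₀ hm0.snd)
  exact ContinuousLinearMap.toSpanSingletonCLE.contDiff.contDiffAt.comp t₀ hv

theorem exists_contDiffAt_orthogonal_parameter {p : ℝ} (hp : 0 < p) {f m : ℝ → ℝ × ℝ} {t₀ : ℝ}
    (hf : ContDiffAt ℝ 1 f t₀) (hm : ContDiffAt ℝ 1 m t₀) (hm₀ : m t₀ ≠ 0)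
    (hfm : HasDerivAt f (pDual p (m t₀).1, pDual p (m t₀).2) t₀) :
    ∃ τ : ℝ × ℝ → ℝ, τ (f t₀) = t₀ ∧ ContDiffAt ℝ 1 τ (f t₀) ∧
      ∀ᶠ v : (ℝ × ℝ) × ℝ in 𝓝 (f t₀, t₀),
        (v.1.1 - (f v.2).1) * (m v.2).1 + (v.1.2 - (f v.2).2) * (m v.2).2 = 0 ↔ τ v.1 = v.2 := by
  let Φ : (ℝ × ℝ) × ℝ → ℝ := fun v =>
    (v.1.1 - (f v.2).1) * (m v.2).1 + (v.1.2 - (f v.2).2) * (m v.2).2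
  have hΦ₀ : Φ (f t₀, t₀) = 0 := by simp [Φ]
  have hΦ : ContDiffAt ℝ 1 Φ (f t₀, t₀) := by
    have hf' : ContDiffAt ℝ 1 (fun v : (ℝ × ℝ) × ℝ => f v.2) (f t₀, t₀) :=
      hf.comp (f t₀, t₀) contDiffAt_snd
    have hm' : ContDiffAt ℝ 1 (fun v : (ℝ × ℝ) × ℝ => m v.2) (f t₀, t₀) :=
      hm.comp (f t₀, t₀) contDiffAt_snd
    exact ((contDiffAt_fst.fst.sub hf'.fst).mul hm'.fst).add
      ((contDiffAt_fst.snd.sub hf'.snd).mul hm'.snd)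
  have hΦ' : HasDerivAt (fun t => Φ (f t₀, t))
      (-(pDual p (m t₀).1 * (m t₀).1 + pDual p (m t₀).2 * (m t₀).2)) t₀ := by
    have hmd : HasDerivAt m (deriv m t₀) t₀ := (hm.differentiableAt (by simp)).hasDerivAt
    have hf₁ : HasDerivAt (fun t => (f t₀).1 - (f t).1) (-pDual p (m t₀).1) t₀ :=
      HasDerivAt.const_sub _ hfm.fst
    have hf₂ : HasDerivAt (fun t => (f t₀).2 - (f t).2) (-pDual p (m t₀).2) t₀ :=
      HasDerivAt.const_sub _ hfm.snd
    refine ((hf₁.mul hmd.fst).add (hf₂.mul hmd.snd)).congr_deriv ?_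
    ring
  simpa only [hΦ₀] using exists_contDiffAt_implicit (by simp) hΦ hΦ'
    (neg_ne_zero.2 (pDual_mul_self_add_ne_zero hp hm₀))

theorem exists_contDiffAt_isPClosest {p : ℝ} (hp : 1 < p) {U : Set (ℝ × ℝ)} {f : ℝ → ℝ × ℝ}
    {t₀ : ℝ} (hf : IsPRegularAt p f t₀) (hfU : map f (𝓝 t₀) = 𝓝[frontier U] (f t₀)) :
    ∃ π : ℝ × ℝ → ℝ × ℝ, ContDiffAt ℝ 1 π (f t₀) ∧
      ∀ᶠ x in 𝓝 (f t₀), IsPClosest p U x (π x) := by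
  have hp0 : 0 < p := by linarith
  have hfC : ContDiffAt ℝ 1 f t₀ := hf.contDiffAt hp
  obtain ⟨m, hm, hm₀, hfm⟩ := hf
  obtain ⟨τ, hτ₀, hτ, hτ_iff⟩ :=
    exists_contDiffAt_orthogonal_parameter hp0 hfC hm hm₀ hfm.self_of_nhds
  refine ⟨f ∘ τ, (hτ₀.symm ▸ hfC : ContDiffAt ℝ 1 f (τ (f t₀))).comp _ hτ, ?_⟩
  have hfrontier : ∀ᶠ t in 𝓝 t₀, f t ∈ frontier U := mem_map.1 (hfU ▸ self_mem_nhdsWithin)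
  have hft₀ : f t₀ ∈ frontier U := hfrontier.self_of_nhds
  rw [nhds_prod_eq, eventually_prod_iff] at hτ_iff
  obtain ⟨P, hP, Q, hQ, hPQ⟩ := hτ_iff
  have himage : ∀ᶠ z in 𝓝 (f t₀), z ∈ frontier U →
      z ∈ f '' {t | Q t ∧ HasDerivAt f (pDual p (m t).1, pDual p (m t).2) t ∧
        ∀ᶠ s in 𝓝 t, f s ∈ frontier U} := by
    rw [← eventually_nhdsWithin_iff, ← hfU]
    exact image_mem_map (hQ.and (hfm.and hfrontier.eventually_nhds))
  filter_upwards [hP, eventually_forall_isPClosest hp0 hft₀ himage] with x hx hclosest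
  obtain ⟨y, hy⟩ := exists_isPClosest hp0 ⟨_, hft₀⟩ x
  obtain ⟨t, ⟨hQt, hft, hst⟩, rfl⟩ := hclosest y hy hy.1
  have hτx : τ x = t := (hPQ hx hQt).1 (hy.orthogonal_of_hasDerivAt hp hft hst)
  rwa [Function.comp_apply, hτx]

theorem mainTheorem6_general {p : ℝ} (hp : 2 ≤ p) {U : Set (ℝ × ℝ)} (hU : IsOpen U)
    {f : ℝ → ℝ × ℝ} {t₀ : ℝ} (hf : IsPRegularAt p f t₀)
    (hfU : map f (𝓝 t₀) = 𝓝[frontier U] (f t₀)) :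
    ∃ W : Set (ℝ × ℝ), IsOpen W ∧ f t₀ ∈ W ∧ Disjoint (W ∩ U) (pRidge p U) := by
  obtain ⟨π, hπ, hclosest⟩ := exists_contDiffAt_isPClosest (by linarith) hf hfU
  have hridge : ∀ᶠ x in 𝓝 (f t₀), x ∈ U → x ∉ pRidge p U := by
    filter_upwards [hπ.eventually (by simp), hclosest.eventually_nhds] with x hπx hcx hx
    have hxU : x ∉ frontier U := fun h => (hU.frontier_eq ▸ h).2 hx
    exact notMem_pRidge_of_contDiffAt hU hx (contDiffAt_pDist hp hπx hcx hxU)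
  obtain ⟨W, hW, hWo, hfW⟩ := eventually_nhds_iff.1 hridge
  exact ⟨W, hWo, hfW, disjoint_left.2 fun x hx => hW x hx.1 hx.2⟩

/-- `g` is near `a` the image under `pDual p` of a function of class `C¹`. This is the regularity
which the axis normal condition imposes on the slope of the boundary at the points where it
vanishes, and which is automatic where the slope is nonzero. -/
def HasPRootAt (p : ℝ) (g : ℝ → ℝ) (a : ℝ) : Prop :=
  ∃ c : ℝ → ℝ, ContDiffAt ℝ 1 c a ∧ ∀ᶠ t in 𝓝 a, g t = pDual p (c t)

section HasPRootAt

variable {p : ℝ} {g h : ℝ → ℝ} {a : ℝ}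

theorem hasPRootAt_of_ne_zero (hp : 1 < p) (hg : ContDiffAt ℝ 1 g a) (hga : g a ≠ 0) :
    HasPRootAt p g a :=
  ⟨fun t => pDual p.conjExponent (g t), (contDiffAt_pDual hga).comp a hg,
    .of_forall fun t => (pDual_pDual (.conjExponent hp) (g t)).symm⟩

theorem HasPRootAt.mul (hg : HasPRootAt p g a) (hh : HasPRootAt p h a) :
    HasPRootAt p (fun t => g t * h t) a := by
  obtain ⟨c, hc, hgc⟩ := hg
  obtain ⟨d, hd, hhd⟩ := hh
  refine ⟨fun t => c t * d t, hc.mul hd, ?_⟩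
  filter_upwards [hgc, hhd] with t hgt hht
  rw [hgt, hht, pDual_mul]

theorem HasPRootAt.comp {φ : ℝ → ℝ} (hg : HasPRootAt p g (φ a)) (hφ : ContDiffAt ℝ 1 φ a) :
    HasPRootAt p (fun t => g (φ t)) a := by
  obtain ⟨c, hc, hgc⟩ := hg
  exact ⟨fun t => c (φ t), hc.comp a hφ, hφ.continuousAt.eventually hgc⟩

theorem HasPRootAt.congr_of_eventuallyEq (hg : HasPRootAt p g a) (hh : h =ᶠ[𝓝 a] g) :
    HasPRootAt p h a := by
  obtain ⟨c, hc, hgc⟩ := hg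
  exact ⟨c, hc, hh.trans hgc⟩

end HasPRootAt

theorem isPRegularAt_of_hasPRootAt {p : ℝ} {f : ℝ → ℝ × ℝ} {t₀ : ℝ}
    (hf : ∀ᶠ t in 𝓝 t₀, DifferentiableAt ℝ f t) (hf₀ : deriv f t₀ ≠ 0)
    (h₁ : HasPRootAt p (fun t => (deriv f t).1) t₀)
    (h₂ : HasPRootAt p (fun t => (deriv f t).2) t₀) : IsPRegularAt p f t₀ := by
  obtain ⟨c₁, hc₁, hfc₁⟩ := h₁
  obtain ⟨c₂, hc₂, hfc₂⟩ := h₂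
  refine ⟨fun t => (c₁ t, c₂ t), hc₁.prodMk hc₂, fun h => hf₀ ?_, ?_⟩
  · obtain ⟨h₁, h₂⟩ := Prod.mk_eq_zero.1 h
    ext
    · simp [hfc₁.self_of_nhds, h₁, pDual]
    · simp [hfc₂.self_of_nhds, h₂, pDual]
  · filter_upwards [hf, hfc₁, hfc₂] with t ht h₁ h₂
    exact ht.hasDerivAt.congr_deriv (Prod.ext h₁ h₂)

theorem exists_contDiffAt_graph {f : ℝ → ℝ × ℝ} {t₀ : ℝ} {n : WithTop ℕ∞} (hn : n ≠ 0)
    (hf : ContDiffAt ℝ n f t₀) (hf₀ : (deriv f t₀).1 ≠ 0) {N : Set ℝ} (hN : N ∈ 𝓝 t₀) :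
    ∃ b : ℝ → ℝ, ContDiffAt ℝ n b 0 ∧ (∀ᶠ t in 𝓝 t₀, (f t).2 = b ((f t).1 - (f t₀).1)) ∧
      ∀ᶠ s in 𝓝 0, ((f t₀).1 + s, b s) ∈ f '' N := by
  let Φ : ℝ × ℝ → ℝ := fun v => (f v.2).1 - (f t₀).1 - v.1
  have hΦ : ContDiffAt ℝ n Φ (0, t₀) := by
    have hf' : ContDiffAt ℝ n (fun v : ℝ × ℝ => f v.2) (0, t₀) := hf.comp (0, t₀) contDiffAt_snd
    exact (hf'.fst.sub contDiffAt_const).sub contDiffAt_fst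
  have hΦ' : HasDerivAt (fun t => Φ (0, t)) (deriv f t₀).1 t₀ :=
    HasDerivAt.sub_const 0 (HasDerivAt.sub_const _ (hf.differentiableAt hn).hasDerivAt.fst)
  obtain ⟨τ, hτ₀, hτ, hΦτ⟩ := exists_contDiffAt_implicit hn hΦ hΦ' hf₀
  have hΦ₀ : Φ (0, t₀) = 0 := by simp [Φ]
  rw [hΦ₀] at hΦτ
  have hfτ : ContDiffAt ℝ n f (τ 0) := hτ₀.symm ▸ hf
  refine ⟨fun s => (f (τ s)).2, (hfτ.comp 0 hτ).snd, ?_, ?_⟩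
  · have hshift : ContinuousAt (fun t => ((f t).1 - (f t₀).1, t)) t₀ :=
      (hf.continuousAt.fst.sub continuousAt_const).prodMk continuousAt_id
    simp only [ContinuousAt, sub_self] at hshift
    filter_upwards [hshift.eventually hΦτ] with t ht
    rw [ht.1 (by simp [Φ])]
  · have hgraph : ContinuousAt (fun s => (s, τ s)) 0 := continuousAt_id.prodMk hτ.continuousAt
    simp only [ContinuousAt, hτ₀] at hgraph
    filter_upwards [hgraph.eventually hΦτ, hτ.continuousAt.eventually (hτ₀.symm ▸ hN)]
      with s hs hsN
    have hfst : (f (τ s)).1 - (f t₀).1 - s = 0 := hs.2 rfl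
    exact ⟨τ s, hsN, Prod.ext (by linear_combination hfst) rfl⟩

theorem VerticalNormalCondition.hasPRootAt_deriv {p : ℝ} {k : ℕ} (hk : 2 ≤ k) {α : ℝ≥0}
    {U V : Set (ℝ × ℝ)} {f : ℝ → ℝ × ℝ} (hA : VerticalNormalCondition p k α U V f) {t₁ t₂ : ℝ}
    (harc : IsArc V f t₁ t₂) {a : ℝ} {b : ℝ → ℝ} (hb : ContDiffAt ℝ k b 0)
    (hbf : ∀ᶠ s in 𝓝 0, (a + s, b s) ∈ f '' Icc t₁ t₂) (hb₀ : deriv b 0 = 0) :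
    HasPRootAt p (deriv b) 0 := by
  have hk0 : (k : WithTop ℕ∞) ≠ 0 := by exact_mod_cast (by omega : k ≠ 0)
  obtain ⟨r, hr, hball⟩ := Metric.nhds_basis_closedBall.eventually_iff.1
    ((hb.eventually (by simp)).and hbf)
  rw [Real.closedBall_eq_Icc, zero_sub, zero_add] at hball
  have hderiv : ∀ s ∈ Icc (-r) r, derivWithin b (Icc (-r) r) s = deriv b s := fun s hs =>
    ((hball hs).1.differentiableAt hk0).derivWithin (uniqueDiffOn_Icc (by linarith) s hs)
  have h0 : (0 : ℝ) ∈ Icc (-r) r := ⟨by linarith, hr.le⟩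
  obtain ⟨c, δ, hδ, hc, -, hbc, -⟩ := hA t₁ t₂ harc a (-r) r b (by linarith) h0
    (fun s hs => (hball hs).1.contDiffWithinAt) (fun s hs => (hball hs).2)
    ((hderiv 0 h0).trans hb₀)
  have hnhds : Icc (-r) r ∩ Icc (-δ) δ ∈ 𝓝 (0 : ℝ) :=
    inter_mem (Icc_mem_nhds (by linarith) hr) (Icc_mem_nhds (by linarith) hδ)
  refine ⟨c, (hc.1.contDiffAt hnhds).of_le (by exact_mod_cast (by omega : 1 ≤ k - 1)), ?_⟩
  filter_upwards [hnhds] with s hs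
  exact (hderiv s hs.1).symm.trans (hbc s hs)

theorem VerticalNormalCondition.hasPRootAt_snd {p : ℝ} (hp : 1 < p) {k : ℕ} (hk : 2 ≤ k) {α : ℝ≥0}
    {U V : Set (ℝ × ℝ)} {f : ℝ → ℝ × ℝ} (hA : VerticalNormalCondition p k α U V f) {t₀ t₁ t₂ : ℝ}
    (harc : IsArc V f t₁ t₂) (ht₀ : t₀ ∈ Ioo t₁ t₂) (hf : ContDiffAt ℝ k f t₀)
    (hf₀ : deriv f t₀ ≠ 0) : HasPRootAt p (fun t => (deriv f t).2) t₀ := by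
  have hk0 : (k : WithTop ℕ∞) ≠ 0 := by exact_mod_cast (by omega : k ≠ 0)
  have hk2 : (1 + 1 : WithTop ℕ∞) ≤ k := by exact_mod_cast hk
  have hf' : ContDiffAt ℝ 1 (deriv f) t₀ := hf.derivWithin hk2
  by_cases h₂ : (deriv f t₀).2 = 0
  swap
  · exact hasPRootAt_of_ne_zero hp hf'.snd h₂
  have h₁ : (deriv f t₀).1 ≠ 0 := fun h₁ => hf₀ (Prod.ext h₁ h₂)
  obtain ⟨b, hb, hfb, hbf⟩ := exists_contDiffAt_graph hk0 hf h₁ (Icc_mem_nhds ht₀.1 ht₀.2)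
  let φ : ℝ → ℝ := fun t => (f t).1 - (f t₀).1
  have hφ₀ : φ t₀ = 0 := sub_self _
  have hφ : ContDiffAt ℝ 1 φ t₀ := (hf.of_le (le_self_add.trans hk2)).fst.sub contDiffAt_const
  have hchain : (fun t => (deriv f t).2) =ᶠ[𝓝 t₀] fun t => deriv b (φ t) * (deriv f t).1 := by
    have hbφ : ∀ᶠ t in 𝓝 t₀, ContDiffAt ℝ k b (φ t) :=
      hφ.continuousAt.eventually (hφ₀.symm ▸ hb.eventually (by simp))
    filter_upwards [hf.eventually (by simp), hbφ, hfb.eventually_nhds] with t hft hbt hfbt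
    have hfd := (hft.differentiableAt hk0).hasDerivAt
    have hcomp := (hbt.differentiableAt hk0).hasDerivAt.comp t (hfd.fst.sub_const (f t₀).1)
    exact HasDerivAt.unique hfd.snd (hcomp.congr_of_eventuallyEq hfbt)
  have hb₀ : deriv b 0 = 0 := by
    simpa only [hφ₀, h₂, zero_eq_mul, h₁, or_false] using hchain.self_of_nhds
  have hroot : HasPRootAt p (deriv b) (φ t₀) := hφ₀.symm ▸ hA.hasPRootAt_deriv hk harc hb hbf hb₀
  exact ((hroot.comp hφ).mul (hasPRootAt_of_ne_zero hp hf'.fst h₁)).congr_of_eventuallyEq hchain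

theorem deriv_swap_comp (f : ℝ → ℝ × ℝ) (t : ℝ) : deriv (Prod.swap ∘ f) t = (deriv f t).swap :=
  DFunLike.congr_fun (ContinuousLinearEquiv.prodComm ℝ ℝ ℝ).comp_fderiv 1

theorem IsArc.swap_comp {V : Set (ℝ × ℝ)} {f : ℝ → ℝ × ℝ} {a b : ℝ} (h : IsArc V f a b) :
    IsArc (Prod.swap '' V) (Prod.swap ∘ f) a b :=
  ⟨h.1, fun t ht hV => h.2 t ht (Prod.swap_injective.mem_set_image.1 hV)⟩

namespace IsPiecewiseSmoothDomain

variable {k : ℕ} {α : ℝ≥0} {U V : Set (ℝ × ℝ)} {L : ℝ} {f : ℝ → ℝ × ℝ}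

theorem map_nhds_eq (hU : IsPiecewiseSmoothDomain k α U V L f) (t : ℝ) :
    map f (𝓝 t) = 𝓝[frontier U] (f t) :=
  hU.range_eq ▸ map_nhds_of_periodic_of_injOn hU.period_pos hU.periodic hU.continuous hU.injOn t

theorem exists_isArc (hU : IsPiecewiseSmoothDomain k α U V L f) {t₀ : ℝ} (ht₀ : f t₀ ∉ V) :
    ∃ t₁ t₂, IsArc V f t₁ t₂ ∧ t₀ ∈ Ioo t₁ t₂ := by
  obtain ⟨t₁, t₂, hmem, hV⟩ := mem_nhds_iff_exists_Ioo_subset.1 <|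
    hU.continuous.continuousAt.preimage_mem_nhds
      (hU.finite_vertices.isClosed.isOpen_compl.mem_nhds ht₀)
  exact ⟨t₁, t₂, ⟨hmem.1.trans hmem.2, hV⟩, hmem⟩

theorem isPRegularAt {p : ℝ} (hp : 1 < p) (hk : 2 ≤ k) (hU : IsPiecewiseSmoothDomain k α U V L f)
    (hA : AxisNormalCondition p k α U V f) {t₀ : ℝ} (ht₀ : f t₀ ∉ V) : IsPRegularAt p f t₀ := by
  obtain ⟨t₁, t₂, harc, hmem⟩ := hU.exists_isArc ht₀
  have hnhds : Icc t₁ t₂ ∈ 𝓝 t₀ := Icc_mem_nhds hmem.1 hmem.2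
  have hf : ContDiffAt ℝ k f t₀ := (hU.arc_smooth t₁ t₂ harc).1.contDiffAt hnhds
  have hf₀ : deriv f t₀ ≠ 0 := by
    rw [← derivWithin_of_mem_nhds hnhds]
    exact hU.arc_regular t₁ t₂ harc t₀ (Ioo_subset_Icc_self hmem)
  have hk0 : (k : WithTop ℕ∞) ≠ 0 := by exact_mod_cast (by omega : k ≠ 0)
  have hswap : deriv (Prod.swap ∘ f) t₀ ≠ 0 := by
    rw [deriv_swap_comp]
    exact fun h => hf₀ (Prod.swap_injective h)
  have hroot₁ : HasPRootAt p (fun t => (deriv f t).1) t₀ := by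
    simpa only [deriv_swap_comp, Prod.snd_swap] using
      hA.2.hasPRootAt_snd hp hk harc.swap_comp hmem (hf.snd.prodMk hf.fst) hswap
  exact isPRegularAt_of_hasPRootAt
    ((hf.eventually (by simp)).mono fun t ht => ht.differentiableAt hk0) hf₀ hroot₁
    (hA.1.hasPRootAt_snd hp hk harc hmem hf hf₀)

end IsPiecewiseSmoothDomain

theorem mainTheorem6 (p : ℝ) (hp : 2 ≤ p) (k : ℕ) (hk : 3 ≤ k)
    (α : ℝ≥0) (hα : 0 < α) (hα' : α < 1)
    (U V : Set (ℝ × ℝ)) (L : ℝ) (f : ℝ → ℝ × ℝ)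
    (hU : IsPiecewiseSmoothDomain k α U V L f)
    (hA : AxisNormalCondition p k α U V f)
    (y₀ : ℝ × ℝ) (hy₀ : y₀ ∈ frontier U \ V) :
    ∃ W : Set (ℝ × ℝ), IsOpen W ∧ y₀ ∈ W ∧ Disjoint (W ∩ U) (pRidge p U) := by
  obtain ⟨t₀, rfl⟩ : y₀ ∈ range f := hU.range_eq ▸ hy₀.1
  exact mainTheorem6_general hp hU.isOpen
    (hU.isPRegularAt (by linarith) (by omega) hA hy₀.2) (hU.map_nhds_eq t₀)
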